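/- Let $V$ be a closed isometric operator in a Hilbert space $H$, that is, a closed linear operator with domain a linear subspace $D(V)\subseteq H$ (not necessarily dense) such that $\|Vf\|=\|f\|$ for $f\in D(V)$; let $R(V)$ be its range and $E_H$ the identity operator of $H$. Put $\mathbb D=\{|z|<1\}$, $\mathbb D_e=\{|z|>1\}$, $\mathbb T=\{|z|=1\}$, and $$M_\zeta=(E_H-\zeta V)D(V),\quad N_\zeta=H\ominus M_\zeta\quad(\zeta\in\mathbb C),\qquad M_\infty=R(V),\quad N_\infty=H\ominus R(V),$$ so that $M_0=D(V)$ and $N_0=H\ominus D(V)$. For a subspace $L$ of $H$, $P_L$ denotes the orthogonal projection of $H$ onto $L$. A number $\mu$ is a point of the regular type of $V$ if $V-\mu E_H$ has a bounded inverse defined on $(V-\mu E_H)D(V)$. For $\zeta\in\mathbb T$ let $W_\zeta$ be the (well-defined, isometric) operator with domain $P_{N_0}N_\zeta$ and values in $N_\infty$ given by $$W_\zeta P_{N_0}f=\zeta^{-1}P_{N_\infty}f,\qquad f\in N_\zeta .$$ A generalized resolvent of $V$ is a function $\mathbf R_z h=P_H(E_{\widetilde H}-zU)^{-1}h$, $h\in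 H$, $z\in\mathbb D\cup\mathbb D_e$, where $U\supseteq V$ is a unitary operator in a Hilbert space $\widetilde H\supseteq H$ and $P_H$ is the orthogonal projection of $\widetilde H$ onto $H$. Let $\Delta$ be an open arc of $\mathbb T$ such that, for every $\zeta\in\Delta$, $\zeta^{-1}$ is a point of the regular type of $V$ and $$P_{M_\infty}M_\zeta=M_\infty .$$ Let $\mathbf R_z$ be an arbitrary generalized resolvent of $V$, and let $C(\lambda)=C(\lambda;0)$, $\lambda\in\mathbb D$, be the analytic function, whose values are linear contractions from $N_0$ into $N_\infty$, that corresponds to it by $$\mathbf R_\lambda=\left[E_H-\lambda\,(V\oplus C(\lambda;0))\right]^{-1},\qquad \lambda\in\mathbb D .$$ Then $\mathbf R_z$ has an analytic continuation to $\mathbb D\cup\mathbb D_e\cup\Delta$ if and only if the following conditions are satisfied: 1) $C(\lambda;0)$ has an extension to $\mathbb D\cup\Delta$ which is continuous in the uniform operator topology; 2) for all $\lambda\in\Delta$ the extended $C(\lambda;0)$ maps $N_0$ isometrically onto the whole of $N_\infty$; 3) for all $\lambda\in\Delta$ the operator $C(\lambda;0)-W_\lambda$ is invertible (that is, injective), and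 $(C(\lambda;0)-W_\lambda)N_0=N_\infty$. -/

import Mathlib

noncomputable section

/-- A closed isometric operator `V` in `H`: a closed linear operator, defined on a linear subspace
`D(V)` of `H` (not assumed dense), that preserves the norm. -/
structure ClosedIsometry (H : Type*) [NormedAddCommGroup H] [InnerProductSpace ℂ H]
    extends H →ₗ.[ℂ] H where
  closed : toLinearPMap.IsClosed
  isometric : ∀ x : domain, ‖toFun x‖ = ‖x‖

namespace ClosedIsometry

section

variable {H : Type*} [NormedAddCommGroup H] [InnerProductSpace ℂ H] [CompleteSpace H]
variable (V : ClosedIsometry H)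

/-- `V` as a linear isometry from `D(V)` into `H`. -/
def toIsometry : V.domain →ₗᵢ[ℂ] H where
  toLinearMap := V.toFun
  norm_map' := V.isometric

/-- The range `M_ζ = (E - ζ V) D(V)`. -/
def M (ζ : ℂ) : Submodule ℂ H := LinearMap.range (V.domain.subtype - ζ • V.toFun)

/-- The defect subspace `N_ζ = H ⊖ M_ζ`. -/
def N (ζ : ℂ) : Submodule ℂ H := (V.M ζ)ᗮ

/-- `M_∞ = R(V)`. -/
def Minf : Submodule ℂ H := LinearMap.range V.toFun

/-- `N_∞ = H ⊖ R(V)`. -/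
def Ninf : Submodule ℂ H := V.Minfᗮ

theorem isClosed_domain : IsClosed (V.domain : Set H) := by
  apply IsSeqClosed.isClosed
  intro x a hx hxa
  have hc : CauchySeq (fun n => V.toIsometry ⟨x n, hx n⟩) := by
    have h1 : CauchySeq (fun n => (⟨x n, hx n⟩ : V.domain)) :=
      V.domain.subtypeₗᵢ.isometry.isUniformInducing.cauchy_map_iff.1 (by
        rw [Filter.map_map]; exact hxa.cauchySeq)
    exact V.toIsometry.isometry.uniformContinuous.comp_cauchySeq h1
  obtain ⟨b, hb⟩ := cauchySeq_tendsto_of_complete hc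
  have hmem : (a, b) ∈ V.graph := by
    have hcl : IsClosed (V.graph : Set (H × H)) := V.closed
    refine hcl.mem_of_tendsto (hxa.prodMk_nhds hb) (Filter.Eventually.of_forall fun n => ?_)
    exact V.mem_graph ⟨x n, hx n⟩
  obtain ⟨y, hy, -⟩ := (LinearPMap.mem_graph_iff _).1 hmem
  have ha : (y : H) = a := hy
  exact ha ▸ y.2

instance : CompleteSpace V.domain := V.isClosed_domain.completeSpace_coe

instance : CompleteSpace V.Minf :=
  (V.toIsometry.isometry.isUniformInducing.isComplete_range).completeSpace_coe

instance (ζ : ℂ) : (V.N ζ).HasOrthogonalProjection :=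
  inferInstanceAs ((V.M ζ)ᗮ).HasOrthogonalProjection

instance : V.Ninf.HasOrthogonalProjection :=
  inferInstanceAs (V.Minfᗮ).HasOrthogonalProjection

/-- `μ` is a point of the regular type of `V`: the operator `V - μ E` has a bounded inverse,
defined on its range. -/
def IsRegularTypePoint (μ : ℂ) : Prop :=
  ∃ c : ℝ, 0 < c ∧ ∀ x : V.domain, c * ‖x‖ ≤ ‖V.toFun x - μ • (x : H)‖

/-- The orthogonal sum `V ⊕ C`, which acts on `H = D(V) ⊕ N_0` as `V` on `D(V)` and as `C` on
`N_0 = H ⊖ D(V)`. -/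
def oplus (C : V.N 0 →L[ℂ] V.Ninf) : H →L[ℂ] H :=
  V.toIsometry.toContinuousLinearMap ∘L V.domain.orthogonalProjectionOnto +
    V.Ninf.subtypeL ∘L C ∘L (V.N 0).orthogonalProjectionOnto

/-- The graph of `W_ζ`: all pairs `(P_{N_0} f, ζ⁻¹ P_{N_∞} f)` with `f ∈ N_ζ`. -/
def graphW (ζ : ℂ) : Submodule ℂ (V.N 0 × V.Ninf) :=
  (V.N ζ).map (((V.N 0).orthogonalProjectionOnto : H →ₗ[ℂ] V.N 0).prod
    (ζ⁻¹ • (V.Ninf.orthogonalProjectionOnto : H →ₗ[ℂ] V.Ninf)))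

/-- The operator `W_ζ` with domain `P_{N_0} N_ζ`, given by
`W_ζ P_{N_0} f = ζ⁻¹ P_{N_∞} f` for `f ∈ N_ζ`. -/
def W (ζ : ℂ) : V.N 0 →ₗ.[ℂ] V.Ninf := (V.graphW ζ).toLinearPMap

/-- For `|ζ| = 1`, the relation that defines `W_ζ` is single-valued. -/
theorem graph_W {ζ : ℂ} (hζ : ‖ζ‖ = 1) : (V.W ζ).graph = V.graphW ζ := by
  apply Submodule.toLinearPMap_graph_eq
  rintro _ ⟨f, hf, rfl⟩ h0
  have h1 : f ∈ V.domain := by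
    have : f ∈ (V.N 0)ᗮ := by
      rw [← Submodule.orthogonalProjectionOnto_eq_zero_iff]; exact h0
    rwa [N, show V.M 0 = V.domain by simp [M], Submodule.orthogonal_orthogonal] at this
  have h2 : inner ℂ (f - ζ • V.toFun ⟨f, h1⟩) f = 0 := hf _ ⟨⟨f, h1⟩, by simp⟩
  have h3 : f = ζ • V.toFun ⟨f, h1⟩ := by
    have hn : ‖V.toFun ⟨f, h1⟩‖ = ‖f‖ := V.isometric ⟨f, h1⟩
    set v := ζ • V.toFun ⟨f, h1⟩ with hv
    have hvn : ‖v‖ = ‖f‖ := by rw [hv, norm_smul, hζ, one_mul, hn]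
    rw [inner_sub_left, sub_eq_zero] at h2
    have h4 := @norm_sub_sq ℂ _ _ _ _ v f
    rw [← h2, inner_self_eq_norm_sq_to_K, hvn] at h4
    norm_cast at h4
    have h5 : ‖v - f‖ ^ 2 = 0 := by
      rw [h4]; ring
    have h6 : v - f = 0 := by simpa using h5
    exact (sub_eq_zero.1 h6).symm
  have h7 : f ∈ V.Ninfᗮ := by
    rw [Ninf, Submodule.orthogonal_orthogonal, h3]
    exact Submodule.smul_mem _ _ ⟨_, rfl⟩
  have h8 := Submodule.orthogonalProjectionOnto_eq_zero_iff.2 h7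
  simp [h8]

/-- `R` is a generalized resolvent of `V`: for some unitary operator `U ⊇ V` in a Hilbert space
`K ⊇ H`, one has `R_z h = P_H (E - z U)⁻¹ h` for `h ∈ H` and `|z| ≠ 1`. The inclusion of `H` into
`K` is an isometric embedding `J`, and the projection of `K` onto `H` is then its adjoint. The
values `R z` with `|z| = 1` play no role. -/
def IsGeneralizedResolvent.{v} (R : ℂ → H →L[ℂ] H) : Prop :=
  ∃ (K : Type v) (_ : NormedAddCommGroup K) (_ : InnerProductSpace ℂ K) (_ : CompleteSpace K)
    (J : H →ₗᵢ[ℂ] K) (U : K ≃ₗᵢ[ℂ] K),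
    (∀ x : V.domain, U (J x) = J (V.toFun x)) ∧
    ∀ z : ℂ, ‖z‖ ≠ 1 →
      R z = J.toContinuousLinearMap.adjoint ∘L
        Ring.inverse (1 - z • ((U : K ≃L[ℂ] K) : K →L[ℂ] K)) ∘L J.toContinuousLinearMap

/-- The formula `R_z = [E - z (V ⊕ C(z))]⁻¹`, `|z| < 1`, by which the parameter
`C(z) = C(z; 0)` corresponds to `R`. -/
def Corresponds (R : ℂ → H →L[ℂ] H) (C : ℂ → V.N 0 →L[ℂ] V.Ninf) : Prop :=
  ∀ z ∈ Metric.ball (0 : ℂ) 1, R z = Ring.inverse (1 - z • V.oplus (C z))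

end

end ClosedIsometry

/-- The class `S(H₁; H₂)` of analytic functions in the open unit disc whose values are linear
contractions from `H₁` into `H₂`. -/
def schurClass (H₁ H₂ : Type*) [NormedAddCommGroup H₁] [NormedSpace ℂ H₁]
    [NormedAddCommGroup H₂] [NormedSpace ℂ H₂] : Set (ℂ → H₁ →L[ℂ] H₂) :=
  {C | AnalyticOnNhd ℂ C (Metric.ball 0 1) ∧ ∀ z ∈ Metric.ball (0 : ℂ) 1, ‖C z‖ ≤ 1}

/-- `Δ` is an open arc of the unit circle (possibly the whole circle). -/
def IsOpenArc (Δ : Set ℂ) : Prop :=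
  ∃ a b : ℝ, a < b ∧ Δ = (fun θ : ℝ => Complex.exp (θ * Complex.I)) '' Set.Ioo a b

end

namespace ClosedIsometry

/-! ### Defect subspaces on the unit circle and the block structure of `1 - ζ • V.oplus C`. -/

section Geometry

variable {H : Type*} [NormedAddCommGroup H] [InnerProductSpace ℂ H]

/-! For ζ in the arc, the two hypotheses yield direct decompositions H = D(V) ∔ N_ζ = M_ζ ∔ N_∞.
Between them E - ζ(V ⊕ C) is diagonal: d ↦ d - ζVd on D(V), and -ζ(C - W_ζ)P_{N_0} on N_ζ. So
condition 3 says exactly that E - ζ(V ⊕ C(ζ)) is invertible (`bijective_one_sub_smul_oplus_iff`).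

The other ingredient is the reflection identity R_z* = E - R_{1/z̄}
(`IsGeneralizedResolvent.star_eq`), inherited from the unitary dilation. On the circle it becomes X
+ X* = E, which is the Cayley-type image of unitarity: it holds for X = (E - ζT)⁻¹ with T isometric
(`ringInverse_add_star_eq_one`), and conversely it makes X invertible and T = ζ⁻¹(E - X⁻¹) unitary
(`smul_one_sub_ringInverse_mem_unitary`).

Given the conditions on C, the inverse of E - z(V ⊕ C(z)) extends R continuously from the disc to
the arc; reflection gives the same boundary values from outside, and a Morera argument
(`analyticOnNhd_union_arc`) gives analyticity. Given the continuation, z⁻¹(E - R_z⁻¹) extends V ⊕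
C(z) continuously to unitary values, and its N_0 → N_∞ corner is the extension of C. -/

theorem M_zero (V : ClosedIsometry H) : V.M 0 = V.domain := by simp [M]

theorem N_zero (V : ClosedIsometry H) : V.N 0 = V.domainᗮ := by rw [N, M_zero]

theorem inner_toFun_toFun (V : ClosedIsometry H) (x y : V.domain) :
    inner ℂ (V.toFun x) (V.toFun y) = inner ℂ (x : H) (y : H) :=
  V.toIsometry.inner_map_map x y

variable [CompleteSpace H] (V : ClosedIsometry H)

theorem oplus_apply (C : V.N 0 →L[ℂ] V.Ninf) (h : H) :
    V.oplus C h = V.toFun (V.domain.orthogonalProjectionOnto h) +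
      (C ((V.N 0).orthogonalProjectionOnto h) : H) := rfl

theorem oplus_apply_domain (C : V.N 0 →L[ℂ] V.Ninf) (x : V.domain) :
    V.oplus C x = V.toFun x := by
  have h : (V.N 0).orthogonalProjectionOnto (x : H) = 0 := by
    rw [Submodule.orthogonalProjectionOnto_eq_zero_iff, N_zero, Submodule.orthogonal_orthogonal]
    exact x.2
  rw [oplus_apply, h, Submodule.orthogonalProjectionOnto_mem_subspace_eq_self]
  simp

theorem oplus_apply_N_zero (C : V.N 0 →L[ℂ] V.Ninf) (n : V.N 0) :
    V.oplus C n = C n := by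
  have h : V.domain.orthogonalProjectionOnto (n : H) = 0 := by
    rw [Submodule.orthogonalProjectionOnto_eq_zero_iff, ← N_zero]
    exact n.2
  rw [oplus_apply, h, Submodule.orthogonalProjectionOnto_mem_subspace_eq_self]
  simp

theorem domain_add_N_zero (h : H) :
    (V.domain.orthogonalProjectionOnto h : H) + ((V.N 0).orthogonalProjectionOnto h : H) = h := by
  have h1 : (V.N 0).starProjection h = h - V.domain.starProjection h := by
    refine Submodule.eq_starProjection_of_mem_orthogonal ?_ ?_
    · rw [N_zero]; exact V.domain.sub_starProjection_mem_orthogonal h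
    · rw [N_zero, Submodule.orthogonal_orthogonal, sub_sub_cancel]
      exact V.domain.starProjection_apply_mem h
  exact add_eq_of_eq_sub' h1

theorem Minf_add_Ninf (h : H) :
    V.Minf.starProjection h + (V.Ninf.orthogonalProjectionOnto h : H) = h :=
  V.Minf.starProjection_add_starProjection_orthogonal h

/-- The defect subspace `N_ζ`, `|ζ| = 1`, consists of all `f` with `P_{M_∞} f = ζ V P_{D(V)} f`. -/
theorem mem_N_iff {ζ : ℂ} (hζ : ‖ζ‖ = 1) (f : H) :
    f ∈ V.N ζ ↔
      V.Minf.starProjection f = ζ • V.toFun (V.domain.orthogonalProjectionOnto f) := by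
  have hconj : ζ * (starRingEnd ℂ) ζ = 1 := by
    rw [Complex.mul_conj, Complex.normSq_eq_norm_sq, hζ]; norm_num
  -- Isometry replaces ⟨x, f⟩ by ⟨Vx, V P_{D(V)} f⟩, and ζ̄ζ = 1 lets ζ̄ be factored out.
  have key (x : V.domain) : inner ℂ ((x : H) - ζ • V.toFun x) f = (starRingEnd ℂ) ζ *
      inner ℂ (V.toFun x)
        (ζ • V.toFun (V.domain.orthogonalProjectionOnto f) - V.Minf.starProjection f) := by
    have h1 : inner ℂ (x : H) f =
        inner ℂ (V.toFun x) (V.toFun (V.domain.orthogonalProjectionOnto f)) := by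
      rw [inner_toFun_toFun]
      exact (Submodule.inner_orthogonalProjectionOnto_eq_of_mem_left x f).symm
    have h2 : inner ℂ (V.toFun x) f = inner ℂ (V.toFun x) (V.Minf.starProjection f) :=
      (Submodule.inner_orthogonalProjectionOnto_eq_of_mem_left
        (⟨V.toFun x, x, rfl⟩ : V.Minf) f).symm
    rw [inner_sub_left, inner_smul_left, inner_sub_right, inner_smul_right, h1, h2]
    linear_combination
      (-inner ℂ (V.toFun x) (V.toFun (V.domain.orthogonalProjectionOnto f))) * hconj
  have hM : ∀ y ∈ V.M ζ, ∃ x : V.domain, y = x - ζ • V.toFun x := by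
    rintro _ ⟨x, rfl⟩
    exact ⟨x, by simp⟩
  constructor
  · intro hf
    set d := ζ • V.toFun (V.domain.orthogonalProjectionOnto f) - V.Minf.starProjection f with hd
    have hdM : d ∈ V.Minf :=
      sub_mem (Submodule.smul_mem _ _ ⟨_, rfl⟩) (V.Minf.starProjection_apply_mem f)
    obtain ⟨x, hx⟩ := hdM
    have h0 : inner ℂ ((x : H) - ζ • V.toFun x) f = 0 := hf _ ⟨x, by simp⟩
    rw [key, hx, mul_eq_zero] at h0
    have hd0 : d = 0 := by
      refine inner_self_eq_zero.1 (h0.resolve_left fun h => ?_)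
      rw [h, mul_zero] at hconj
      exact zero_ne_one hconj
    exact (sub_eq_zero.1 hd0).symm
  · intro hf y hy
    obtain ⟨x, rfl⟩ := hM y hy
    rw [key, hf, sub_self, inner_zero_right, mul_zero]

/-- By `mem_N_iff`, the M_∞-components of f and of ζ(V ⊕ C)f cancel, so only N_∞-components survive.
-/
theorem sub_smul_oplus_apply {ζ : ℂ} (hζ : ‖ζ‖ = 1) (C : V.N 0 →L[ℂ] V.Ninf) {f : H}
    (hf : f ∈ V.N ζ) :
    f - ζ • V.oplus C f = -(ζ • ((C ((V.N 0).orthogonalProjectionOnto f) -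
      ζ⁻¹ • V.Ninf.orthogonalProjectionOnto f : V.Ninf) : H)) := by
  have h0 : ζ ≠ 0 := by rintro rfl; simp at hζ
  have h1 := V.Minf_add_Ninf f
  rw [(V.mem_N_iff hζ f).1 hf] at h1
  rw [oplus_apply, Submodule.coe_sub, Submodule.coe_smul, smul_sub, smul_inv_smul₀ h0]
  nth_rewrite 1 [← h1]
  rw [smul_add]
  abel

variable {V}

/-- The projection of x onto M_∞ has the norm of x, so x lies in M_∞ and x = ζVx; regularity at ζ⁻¹
excludes such an eigenvector. The next two lemmas deduce that both sums in the decompositions are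
direct. -/
theorem IsRegularTypePoint.eq_zero {ζ : ℂ} (hreg : V.IsRegularTypePoint ζ⁻¹) (hζ : ‖ζ‖ = 1)
    {x : V.domain} (hx : V.Minf.starProjection (x : H) = ζ • V.toFun x) : x = 0 := by
  have h0 : ζ ≠ 0 := by rintro rfl; simp at hζ
  have h1 : (x : H) ∈ V.Minf := by
    rw [Submodule.mem_iff_norm_starProjection, hx, norm_smul, hζ, one_mul]
    exact V.isometric x
  rw [Submodule.starProjection_eq_self_iff.2 h1] at hx
  obtain ⟨c, hc, h⟩ := hreg
  have h2 := h x
  rw [hx, inv_smul_smul₀ h0, sub_self, norm_zero] at h2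
  have h3 : ‖x‖ ≤ 0 := by
    by_contra! h3
    exact absurd h2 (not_le.2 (mul_pos hc h3))
  exact norm_le_zero_iff.1 h3

theorem IsRegularTypePoint.eq_zero_of_mem_Ninf {ζ : ℂ} (hreg : V.IsRegularTypePoint ζ⁻¹)
    (hζ : ‖ζ‖ = 1) {x : V.domain} (hx : (x : H) - ζ • V.toFun x ∈ V.Ninf) : x = 0 := by
  refine hreg.eq_zero hζ ?_
  have h1 := (Submodule.starProjection_apply_eq_zero_iff _).2 hx
  rw [map_sub, sub_eq_zero] at h1
  rw [h1]
  exact Submodule.starProjection_eq_self_iff.2 (Submodule.smul_mem _ _ ⟨x, rfl⟩)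

theorem IsRegularTypePoint.eq_zero_of_mem_N {ζ : ℂ} (hreg : V.IsRegularTypePoint ζ⁻¹)
    (hζ : ‖ζ‖ = 1) {x : V.domain} (hx : (x : H) ∈ V.N ζ) : x = 0 := by
  refine hreg.eq_zero hζ ?_
  rw [(V.mem_N_iff hζ _).1 hx, Submodule.orthogonalProjectionOnto_mem_subspace_eq_self]

/-- With n the N_0-component of h, `mem_N_iff` turns g + n ∈ N_ζ, for g in D(V), into P_{M_∞}(g -
ζVg) = -P_{M_∞} n, which `hproj` solves. -/
theorem exists_mem_N_add {ζ : ℂ} (hζ : ‖ζ‖ = 1)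
    (hproj : (V.M ζ).map (V.Minf.starProjection : H →ₗ[ℂ] H) = V.Minf) (h : H) :
    ∃ d : V.domain, ∃ f ∈ V.N ζ, h = d + f := by
  set n := (V.N 0).orthogonalProjectionOnto h
  have h1 : -V.Minf.starProjection (n : H) ∈ (V.M ζ).map (V.Minf.starProjection : H →ₗ[ℂ] H) := by
    rw [hproj]; exact neg_mem (V.Minf.starProjection_apply_mem _)
  obtain ⟨_, ⟨g, rfl⟩, hg⟩ := h1
  have hg' : V.Minf.starProjection (g : H) - ζ • V.toFun g =
      -V.Minf.starProjection (n : H) := by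
    rw [← hg]
    have : V.Minf.starProjection (ζ • V.toFun g) = ζ • V.toFun g :=
      Submodule.starProjection_eq_self_iff.2 (Submodule.smul_mem _ _ ⟨g, rfl⟩)
    simp only [LinearMap.sub_apply, Submodule.subtype_apply, LinearMap.smul_apply,
      ContinuousLinearMap.coe_coe, map_sub, this]
  refine ⟨V.domain.orthogonalProjectionOnto h - g, g + n, ?_, ?_⟩
  · have hn : V.domain.orthogonalProjectionOnto (n : H) = 0 := by
      rw [Submodule.orthogonalProjectionOnto_eq_zero_iff, ← N_zero]
      exact n.2
    rw [V.mem_N_iff hζ, map_add, map_add, hn, add_zero,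
      Submodule.orthogonalProjectionOnto_mem_subspace_eq_self]
    rw [sub_eq_iff_eq_add] at hg'
    rw [hg']
    abel
  · rw [Submodule.coe_sub]
    nth_rewrite 1 [← V.domain_add_N_zero h]
    abel

theorem exists_mem_M_add {ζ : ℂ}
    (hproj : (V.M ζ).map (V.Minf.starProjection : H →ₗ[ℂ] H) = V.Minf) (h : H) :
    ∃ d : V.domain, ∃ y : V.Ninf, h = (d - ζ • V.toFun d) + y := by
  have h1 : V.Minf.starProjection h ∈ (V.M ζ).map (V.Minf.starProjection : H →ₗ[ℂ] H) := by
    rw [hproj]; exact V.Minf.starProjection_apply_mem _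
  obtain ⟨_, ⟨g, rfl⟩, hg⟩ := h1
  refine ⟨g, ⟨h - (g - ζ • V.toFun g), ?_⟩, by simp⟩
  refine (Submodule.starProjection_apply_eq_zero_iff _).1 ?_
  rw [map_sub, sub_eq_zero]
  exact hg.symm

theorem W_apply {ζ : ℂ} (hζ : ‖ζ‖ = 1) {f : H} (hf : f ∈ V.N ζ) :
    ∃ hx : (V.N 0).orthogonalProjectionOnto f ∈ (V.W ζ).domain,
      V.W ζ ⟨_, hx⟩ = ζ⁻¹ • V.Ninf.orthogonalProjectionOnto f := by
  have h : ((V.N 0).orthogonalProjectionOnto f, ζ⁻¹ • V.Ninf.orthogonalProjectionOnto f) ∈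
      (V.W ζ).graph := by
    rw [V.graph_W hζ]
    exact ⟨f, hf, rfl⟩
  obtain ⟨⟨y, hy⟩, h1, h2⟩ := (LinearPMap.mem_graph_iff _).1 h
  obtain rfl : y = _ := h1
  exact ⟨hy, h2⟩

theorem exists_of_mem_domain_W {ζ : ℂ} (hζ : ‖ζ‖ = 1) (x : (V.W ζ).domain) :
    ∃ f ∈ V.N ζ, (V.N 0).orthogonalProjectionOnto f = x ∧
      V.W ζ x = ζ⁻¹ • V.Ninf.orthogonalProjectionOnto f := by
  have h := (V.W ζ).mem_graph x
  rw [V.graph_W hζ] at h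
  obtain ⟨f, hf, h1⟩ := h
  exact ⟨f, hf, congrArg Prod.fst h1, (congrArg Prod.snd h1).symm⟩

theorem toPMap_sub_W_apply {ζ : ℂ} (hζ : ‖ζ‖ = 1) (C : V.N 0 →L[ℂ] V.Ninf)
    (x : ((C : V.N 0 →ₗ[ℂ] V.Ninf).toPMap ⊤ - V.W ζ).domain) :
    ∃ f ∈ V.N ζ, (V.N 0).orthogonalProjectionOnto f = x ∧
      f - ζ • V.oplus C f =
        -(ζ • ((((C : V.N 0 →ₗ[ℂ] V.Ninf).toPMap ⊤ - V.W ζ) x : V.Ninf) : H)) := by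
  obtain ⟨f, hf, h1, h2⟩ := exists_of_mem_domain_W (V := V) hζ ⟨x, x.2.2⟩
  refine ⟨f, hf, h1, ?_⟩
  rw [V.sub_smul_oplus_apply hζ C hf, h1, ← h2]
  rfl

theorem exists_toPMap_sub_W_apply {ζ : ℂ} (hζ : ‖ζ‖ = 1) (C : V.N 0 →L[ℂ] V.Ninf)
    {f : H} (hf : f ∈ V.N ζ) :
    ∃ x : ((C : V.N 0 →ₗ[ℂ] V.Ninf).toPMap ⊤ - V.W ζ).domain,
      (V.N 0).orthogonalProjectionOnto f = x ∧
      f - ζ • V.oplus C f =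
        -(ζ • ((((C : V.N 0 →ₗ[ℂ] V.Ninf).toPMap ⊤ - V.W ζ) x : V.Ninf) : H)) := by
  obtain ⟨hx, h2⟩ := W_apply hζ hf
  refine ⟨⟨_, trivial, hx⟩, rfl, ?_⟩
  rw [V.sub_smul_oplus_apply hζ C hf, ← h2]
  rfl

/-- With respect to the decompositions `H = D(V) ∔ N_ζ` and `H = M_ζ ∔ N_∞`, the operator
`E - ζ (V ⊕ C)` is diagonal; hence it is bijective exactly if `C - W_ζ` is. -/
theorem bijective_one_sub_smul_oplus_iff {ζ : ℂ} (hζ : ‖ζ‖ = 1)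
    (hreg : V.IsRegularTypePoint ζ⁻¹)
    (hproj : (V.M ζ).map (V.Minf.starProjection : H →ₗ[ℂ] H) = V.Minf)
    (C : V.N 0 →L[ℂ] V.Ninf) :
    Function.Bijective (1 - ζ • V.oplus C : H →L[ℂ] H) ↔
      Function.Injective ((C : V.N 0 →ₗ[ℂ] V.Ninf).toPMap ⊤ - V.W ζ) ∧
        Set.range ((C : V.N 0 →ₗ[ℂ] V.Ninf).toPMap ⊤ - V.W ζ) = Set.univ := by
  have h0 : ζ ≠ 0 := by rintro rfl; simp at hζ
  have hA (h : H) : (1 - ζ • V.oplus C : H →L[ℂ] H) h = h - ζ • V.oplus C h := rfl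
  have hAd (d : V.domain) :
      (1 - ζ • V.oplus C : H →L[ℂ] H) (d : H) = d - ζ • V.toFun d := by
    rw [hA, oplus_apply_domain]
  set S := (C : V.N 0 →ₗ[ℂ] V.Ninf).toPMap ⊤ - V.W ζ
  have hSinj : Function.Injective S ↔ ∀ x, S x = 0 → x = 0 :=
    injective_iff_map_eq_zero S.toFun
  rw [hSinj, Set.range_eq_univ, Function.Bijective, injective_iff_map_eq_zero]
  constructor
  · rintro ⟨hinj, hsurj⟩
    refine ⟨fun x hx => ?_, fun y => ?_⟩
    · obtain ⟨f, hf, h1, h2⟩ := toPMap_sub_W_apply hζ C x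
      have hf0 : f = 0 := by
        refine hinj f ?_
        rw [hA, h2]
        change -(ζ • ((S x : V.Ninf) : H)) = 0
        simp [hx]
      rw [hf0, map_zero] at h1
      exact Subtype.ext h1.symm
    · obtain ⟨h, hh⟩ := hsurj (-(ζ • (y : H)))
      obtain ⟨d, f, hf, rfl⟩ := exists_mem_N_add hζ hproj h
      obtain ⟨x, -, hx⟩ := exists_toPMap_sub_W_apply hζ C hf
      change _ = -(ζ • ((S x : V.Ninf) : H)) at hx
      rw [map_add, hAd, hA f, hx] at hh
      -- The equation `hh` places d - ζVd in N_∞, which meets M_ζ trivially.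
      have hd : d = 0 := by
        refine hreg.eq_zero_of_mem_Ninf hζ ?_
        rw [eq_sub_of_add_eq hh]
        exact sub_mem (neg_mem (Submodule.smul_mem _ _ y.2))
          (neg_mem (Submodule.smul_mem _ _ (S x).2))
      refine ⟨x, Subtype.ext ?_⟩
      rw [hd] at hh
      simpa [h0] using hh
  · rintro ⟨hinj, hsurj⟩
    refine ⟨fun h hh => ?_, fun h => ?_⟩
    · obtain ⟨d, f, hf, rfl⟩ := exists_mem_N_add hζ hproj h
      obtain ⟨x, hfx, hx⟩ := exists_toPMap_sub_W_apply hζ C hf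
      change _ = -(ζ • ((S x : V.Ninf) : H)) at hx
      rw [map_add, hAd, hA f, hx] at hh
      have hd : d = 0 := by
        refine hreg.eq_zero_of_mem_Ninf hζ ?_
        rw [eq_neg_of_add_eq_zero_left hh, neg_neg]
        exact Submodule.smul_mem _ _ (S x).2
      rw [hd] at hh
      have hSx : S x = 0 := Subtype.ext (by simpa [h0] using hh)
      rw [hinj x hSx] at hfx
      have hfd : f ∈ V.domain := by
        have := Submodule.orthogonalProjectionOnto_eq_zero_iff.1 hfx
        rwa [N_zero, Submodule.orthogonal_orthogonal] at this
      have hf0 := hreg.eq_zero_of_mem_N hζ (x := ⟨f, hfd⟩) hf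
      have hf0' : f = 0 := congrArg Subtype.val hf0
      rw [hd, hf0']
      simp
    · obtain ⟨d, y, rfl⟩ := exists_mem_M_add hproj h
      obtain ⟨x, hx⟩ := hsurj (-(ζ⁻¹ • y))
      obtain ⟨f, hf, -, h2⟩ := toPMap_sub_W_apply hζ C x
      change _ = -(ζ • ((S x : V.Ninf) : H)) at h2
      refine ⟨d + f, ?_⟩
      rw [map_add, hAd, hA f, h2, hx]
      simp [h0]

end Geometry

end ClosedIsometry

/-! ### Analytic continuation across an arc by Morera's theorem. -/

section Continuation

open Complex Set Metric Filter Topology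
open scoped Interval

variable {E : Type*} [NormedAddCommGroup E] [NormedSpace ℂ E]

/-- The integral over the boundary of a rectangle vanishes if the function is continuous on the
rectangle and differentiable off the real axis. -/
theorem Complex.isConservativeOn_of_differentiableAt_off_real {F : ℂ → E} {U : Set ℂ}
    (hc : ContinuousOn F U) (hd : ∀ z ∈ U, z.im ≠ 0 → DifferentiableAt ℂ F z) :
    IsConservativeOn F U := by
  intro z w hzw
  rw [← add_eq_zero_iff_eq_neg, wedgeIntegral_add_wedgeIntegral_eq]
  have hcR : ContinuousOn F ([[z.re, w.re]] ×ℂ [[z.im, w.im]]) := hc.mono hzw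
  have hdR : ∀ x ∈ [[z.re, w.re]] ×ℂ [[z.im, w.im]], x.im ≠ 0 → DifferentiableAt ℂ F x :=
    fun x hx => hd x (hzw hx)
  -- Cauchy's theorem for a subrectangle whose interior misses the real axis. A rectangle crossing
  -- the axis is cut at height 0, and the two integrals along the cut cancel.
  have sub (s t : ℝ) (hs : s ∈ [[z.im, w.im]]) (ht : t ∈ [[z.im, w.im]])
      (h0 : (0 : ℝ) ∉ Ioo (min s t) (max s t)) :
      (∫ x : ℝ in z.re..w.re, F (x + s * I)) - (∫ x : ℝ in z.re..w.re, F (x + t * I)) +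
        I • (∫ y : ℝ in s..t, F (w.re + y * I)) - I • (∫ y : ℝ in s..t, F (z.re + y * I)) = 0 := by
    have hst : [[s, t]] ⊆ [[z.im, w.im]] := uIcc_subset_uIcc hs ht
    have := integral_boundary_rect_eq_zero_of_continuousOn_of_differentiableOn F
      (⟨z.re, s⟩ : ℂ) ⟨w.re, t⟩ (hcR.mono fun x hx => ⟨hx.1, hst hx.2⟩) (fun x hx => by
        refine (hdR x ⟨Ioo_subset_Icc_self hx.1, hst (Ioo_subset_Icc_self hx.2)⟩
          fun h => h0 ?_).differentiableWithinAt
        rw [← h]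
        exact hx.2)
    simpa using this
  by_cases h0 : (0 : ℝ) ∈ [[z.im, w.im]]
  · have h1 := sub z.im 0 left_mem_uIcc h0 (by rcases le_total z.im 0 with h | h <;> simp [h])
    have h2 := sub 0 w.im h0 right_mem_uIcc (by rcases le_total w.im 0 with h | h <;> simp [h])
    have hint (u : ℝ) (hu : u ∈ [[z.re, w.re]]) (s t : ℝ) (hs : s ∈ [[z.im, w.im]])
        (ht : t ∈ [[z.im, w.im]]) :
        IntervalIntegrable (fun y : ℝ => F (u + y * I)) MeasureTheory.volume s t := by
      refine ContinuousOn.intervalIntegrable (hcR.comp (by fun_prop) fun y hy => ?_)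
      have hy' := uIcc_subset_uIcc hs ht hy
      refine ⟨?_, ?_⟩ <;> simpa
    have hw := intervalIntegral.integral_add_adjacent_intervals
      (hint w.re right_mem_uIcc z.im 0 left_mem_uIcc h0)
      (hint w.re right_mem_uIcc 0 w.im h0 right_mem_uIcc)
    have hz := intervalIntegral.integral_add_adjacent_intervals
      (hint z.re left_mem_uIcc z.im 0 left_mem_uIcc h0)
      (hint z.re left_mem_uIcc 0 w.im h0 right_mem_uIcc)
    rw [← hw, ← hz, ← add_zero (0 : E)]
    nth_rewrite 1 [← h1]
    nth_rewrite 1 [← h2]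
    simp only [smul_add]
    abel
  · exact sub z.im w.im left_mem_uIcc right_mem_uIcc fun h => h0 (Ioo_subset_Icc_self h)

variable [CompleteSpace E]

theorem Complex.differentiableOn_ball_of_differentiableAt_off_real {F : ℂ → E} {c : ℂ} {r : ℝ}
    (hc : ContinuousOn F (ball c r)) (hd : ∀ z ∈ ball c r, z.im ≠ 0 → DifferentiableAt ℂ F z) :
    DifferentiableOn ℂ F (ball c r) :=
  ((isConservativeOn_of_differentiableAt_off_real hc hd).isExactOn_ball hc).differentiableOn
    isOpen_ball

theorem Complex.norm_exp_mul_I (w : ℂ) : ‖exp (w * I)‖ = Real.exp (-w.im) := by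
  simp [norm_exp]

/-- A function that is holomorphic off the unit circle and has, on an open arc, continuous boundary
values from both sides is analytic across that arc. -/
theorem analyticOnNhd_union_arc {f : ℂ → E} {Δ : Set ℂ} (hΔ : IsOpenArc Δ)
    (hd : ∀ z, ‖z‖ ≠ 1 → DifferentiableAt ℂ f z)
    (hin : ContinuousOn f (ball 0 1 ∪ Δ)) (hout : ContinuousOn f ({z | 1 < ‖z‖} ∪ Δ)) :
    AnalyticOnNhd ℂ f ({z | ‖z‖ < 1 ∨ 1 < ‖z‖} ∪ Δ) := by
  rintro ζ (hζ | hζ)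
  · have hopen : IsOpen {z : ℂ | ‖z‖ < 1 ∨ 1 < ‖z‖} :=
      (isOpen_lt continuous_norm continuous_const).union
        (isOpen_lt continuous_const continuous_norm)
    exact DifferentiableOn.analyticAt
      (fun z hz => (hd z (hz.elim ne_of_lt ne_of_gt)).differentiableWithinAt) (hopen.mem_nhds hζ)
  obtain ⟨a, b, -, rfl⟩ := hΔ
  obtain ⟨θ, hθ, rfl⟩ := hζ
  set Δ := (fun θ : ℝ => exp (θ * I)) '' Ioo a b
  -- The map w ↦ exp(iw) straightens the arc: real w go to the circle, the upper half-plane to the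
  -- disc and the lower one to its exterior.
  set F : ℂ → E := fun w => f (exp (w * I)) with hF
  set r := min (θ - a) (b - θ) with hr
  have hr0 : 0 < r := lt_min (sub_pos.2 hθ.1) (sub_pos.2 hθ.2)
  have hre : ∀ w ∈ ball (θ : ℂ) r, w.re ∈ Ioo a b := by
    intro w hw
    have h1 : |w.re - θ| < r := by
      have := abs_re_le_norm (w - θ)
      rw [sub_re, ofReal_re] at this
      exact this.trans_lt (by simpa [dist_eq_norm] using hw)
    have h2 := abs_lt.1 h1
    have h3 := min_le_left (θ - a) (b - θ)
    have h4 := min_le_right (θ - a) (b - θ)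
    constructor <;> linarith
  have hmem : ∀ w ∈ ball (θ : ℂ) r, w.im = 0 → exp (w * I) ∈ Δ := by
    intro w hw h0
    refine ⟨w.re, hre w hw, ?_⟩
    have : (w.re : ℂ) = w := Complex.ext (by simp) (by simp [h0])
    simp [this]
  have hdF : ∀ w ∈ ball (θ : ℂ) r, w.im ≠ 0 → DifferentiableAt ℂ F w := by
    intro w _ h0
    have h1 : ‖exp (w * I)‖ ≠ 1 := by
      rw [norm_exp_mul_I]
      simpa using h0
    exact (hd _ h1).comp w (by fun_prop)
  have hcF : ContinuousOn F (ball (θ : ℂ) r) := by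
    have hup : ContinuousOn F (ball (θ : ℂ) r ∩ {w | 0 ≤ w.im}) := by
      refine hin.comp (by fun_prop) ?_
      rintro w ⟨hw, h0⟩
      rcases eq_or_lt_of_le (show 0 ≤ w.im from h0) with h | h
      · exact Or.inr (hmem w hw h.symm)
      · left
        rw [mem_ball_zero_iff, norm_exp_mul_I]
        simpa using h
    have hdown : ContinuousOn F (ball (θ : ℂ) r ∩ {w | w.im ≤ 0}) := by
      refine hout.comp (by fun_prop) ?_
      rintro w ⟨hw, h0⟩
      rcases eq_or_lt_of_le (show w.im ≤ 0 from h0) with h | h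
      · exact Or.inr (hmem w hw h)
      · left
        rw [mem_ofPred_eq, norm_exp_mul_I]
        simpa using h
    intro w hw
    by_cases h0 : w.im = 0
    · refine ((hup w ⟨hw, h0.ge⟩).union (hdown w ⟨hw, h0.le⟩)).mono fun v hv => ?_
      exact (le_total 0 v.im).imp (fun h => ⟨hv, h⟩) fun h => ⟨hv, h⟩
    · exact (hdF w hw h0).continuousAt.continuousWithinAt
  have hA : AnalyticAt ℂ F θ :=
    (differentiableOn_ball_of_differentiableAt_off_real hcF hdF).analyticAt (ball_mem_nhds _ hr0)
  set ζ := exp (θ * I) with hζ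
  have hζ0 : ζ ≠ 0 := exp_ne_zero _
  -- A right inverse of w ↦ exp(iw); dividing by ζ keeps the branch cut away from z = ζ.
  set g : ℂ → ℂ := fun z => θ - I * log (z / ζ) with hg
  have hgA : AnalyticAt ℂ g ζ := by
    refine analyticAt_const.sub (analyticAt_const.mul (AnalyticAt.clog ?_ ?_))
    · exact analyticAt_id.div analyticAt_const hζ0
    · simp [div_self hζ0]
  have hgζ : g ζ = θ := by simp [hg, div_self hζ0]
  have hcomp : AnalyticAt ℂ (F ∘ g) ζ := AnalyticAt.comp (by rwa [hgζ]) hgA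
  refine hcomp.congr ?_
  filter_upwards [isOpen_ne.mem_nhds hζ0] with z hz
  have : exp (g z * I) = z := by
    have h1 : g z * I = θ * I + log (z / ζ) := by
      simp only [hg]
      linear_combination (-log (z / ζ)) * I_mul_I
    rw [h1, exp_add, exp_log (div_ne_zero hz hζ0), ← hζ, mul_div_cancel₀ _ hζ0]
  simp [hF, this]

end Continuation

/-! ### Unitary operators and the equation X + X* = 1. -/

section Operators

open Filter Topology

variable {H : Type*} [NormedAddCommGroup H] [InnerProductSpace ℂ H] [CompleteSpace H]

theorem isUnit_one_sub_smul_of_mem_unitary {u : H →L[ℂ] H} (hu : u ∈ unitary (H →L[ℂ] H)) {z : ℂ}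
    (hz : ‖z‖ ≠ 1) : IsUnit (1 - z • u) := by
  rcases eq_or_ne z 0 with rfl | h0
  · simp
  have h1 : z⁻¹ ∉ spectrum ℂ u := fun h => hz (by
    simpa using spectrum.subset_circle_of_unitary hu h)
  have h2 := (spectrum.notMem_iff.1 h1).smul (Units.mk0 z h0)
  convert h2 using 1
  ext x
  simp [Algebra.algebraMap_eq_smul_one, Units.smul_def, smul_sub, h0]

/-- For unitary `u` and `|z| ≠ 0, 1`, the resolvents at `z` and at its reflection in the unit circle
satisfy `((1 - z u)⁻¹)* = 1 - (1 - u / z̄)⁻¹`. -/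
theorem star_ringInverse_one_sub_smul {u : H →L[ℂ] H} (hu : u ∈ unitary (H →L[ℂ] H)) {z : ℂ}
    (h0 : z ≠ 0) (hz : ‖z‖ ≠ 1) :
    star (Ring.inverse (1 - z • u)) =
      1 - Ring.inverse (1 - ((starRingEnd ℂ) z)⁻¹ • u) := by
  set w := ((starRingEnd ℂ) z)⁻¹ with hw
  have hc0 : (starRingEnd ℂ) z ≠ 0 := by simpa using h0
  have hwn : ‖w‖ ≠ 1 := by
    rw [hw, norm_inv, RCLike.norm_conj]
    simpa using hz
  have hBw := isUnit_one_sub_smul_of_mem_unitary hu hwn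
  have hB := (isUnit_one_sub_smul_of_mem_unitary hu hz).star
  have huu : u * star u = 1 := (Unitary.mem_iff.1 hu).2
  have hsB : star (1 - z • u) = 1 - (starRingEnd ℂ) z • star u := by simp
  have hfac : star (1 - z • u) = -((1 - w • u) * ((starRingEnd ℂ) z • star u)) := by
    rw [hsB, sub_mul, one_mul, smul_mul_smul_comm, huu, hw, inv_mul_cancel₀ hc0, one_smul]
    abel
  have hX : (1 - Ring.inverse (1 - w • u)) * star (1 - z • u) = 1 := by
    rw [sub_mul, one_mul]
    nth_rewrite 2 [hfac]
    rw [mul_neg, ← mul_assoc, Ring.inverse_mul_cancel _ hBw, one_mul, hsB]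
    abel
  rw [← Ring.inverse_star]
  calc Ring.inverse (star (1 - z • u))
      = (1 - Ring.inverse (1 - w • u)) * star (1 - z • u) * Ring.inverse (star (1 - z • u)) := by
        rw [hX, one_mul]
    _ = 1 - Ring.inverse (1 - w • u) := by
        rw [mul_assoc, Ring.mul_inverse_cancel _ hB, mul_one]

/-- The real part of ⟨Xx, x⟩ is ‖x‖²/2, so X is coercive. -/
theorem isUnit_of_add_star_eq_one {X : H →L[ℂ] H} (hX : X + star X = 1) : IsUnit X := by
  refine X.isUnit_of_forall_le_norm_inner_map (c := 1 / 2) (by norm_num) fun x => ?_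
  have h1 : inner ℂ (X x) x + inner ℂ x (X x) = inner ℂ x x := by
    have h : X x + star X x = x := congrArg (fun T : H →L[ℂ] H => T x) hX
    nth_rewrite 5 [← h]
    rw [inner_add_left, ContinuousLinearMap.star_eq_adjoint,
      ContinuousLinearMap.adjoint_inner_left]
  have h2 : ‖x‖ ^ 2 = ‖inner ℂ (X x) x + inner ℂ x (X x)‖ := by
    rw [h1, inner_self_eq_norm_sq_to_K]
    simp
  have h3 := norm_add_le (inner ℂ (X x) x) (inner ℂ x (X x))
  rw [norm_inner_symm x (X x)] at h3
  push_cast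
  linarith

/-- With A = 1 - ζT, isometry gives A* + A = A*A; multiply by the inverses of A* and A on either
side. -/
theorem ringInverse_add_star_eq_one {T : H →L[ℂ] H} (hT : star T * T = 1) {ζ : ℂ} (hζ : ‖ζ‖ = 1)
    (hu : IsUnit (1 - ζ • T)) :
    Ring.inverse (1 - ζ • T) + star (Ring.inverse (1 - ζ • T)) = 1 := by
  have hconj : (starRingEnd ℂ) ζ * ζ = 1 := by
    rw [mul_comm, Complex.mul_conj, Complex.normSq_eq_norm_sq, hζ]; norm_num
  have hsA : star (1 - ζ • T) = 1 - (starRingEnd ℂ) ζ • star T := by simp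
  have hA : star (1 - ζ • T) + (1 - ζ • T) = star (1 - ζ • T) * (1 - ζ • T) := by
    rw [hsA, sub_mul, one_mul, mul_sub, smul_mul_smul_comm, hT, hconj, mul_one, one_smul]
    abel
  set A := 1 - ζ • T
  have h1 := Ring.mul_inverse_cancel A hu
  have h2 := Ring.inverse_mul_cancel _ hu.star
  rw [← Ring.inverse_star]
  calc Ring.inverse A + Ring.inverse (star A)
      = Ring.inverse (star A) * (star A + A) * Ring.inverse A := by
        rw [mul_add, h2, add_mul, one_mul, mul_assoc, h1, mul_one]
    _ = 1 := by rw [hA, ← mul_assoc, h2, one_mul, h1]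

/-- For A = X⁻¹ the hypothesis becomes A*A = A + A* = AA*, which says that 1 - A is unitary. -/
theorem smul_one_sub_ringInverse_mem_unitary {X : H →L[ℂ] H} (hX : X + star X = 1) {ζ : ℂ}
    (hζ : ‖ζ‖ = 1) : ζ⁻¹ • (1 - Ring.inverse X) ∈ unitary (H →L[ℂ] H) := by
  have hu := isUnit_of_add_star_eq_one hX
  have h1 := Ring.mul_inverse_cancel X hu
  have h2 := Ring.inverse_mul_cancel X hu
  have h3 := Ring.mul_inverse_cancel _ hu.star
  have h4 := Ring.inverse_mul_cancel _ hu.star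
  rw [Ring.inverse_star] at h3 h4
  set A := Ring.inverse X
  have hconj : (starRingEnd ℂ) ζ⁻¹ * ζ⁻¹ = 1 := by
    rw [mul_comm, Complex.mul_conj, Complex.normSq_eq_norm_sq, norm_inv, hζ]; norm_num
  have hconj' : ζ⁻¹ * (starRingEnd ℂ) ζ⁻¹ = 1 := by rw [mul_comm, hconj]
  have e1 : star A * A = A + star A := by
    calc star A * A = star A * (X + star X) * A := by rw [hX, mul_one]
      _ = A + star A := by
        rw [mul_add, h4, add_mul, one_mul, mul_assoc, h1, mul_one, add_comm]
  have e2 : A * star A = A + star A := by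
    calc A * star A = A * (X + star X) * star A := by rw [hX, mul_one]
      _ = A + star A := by
        rw [mul_add, h2, add_mul, one_mul, mul_assoc, h3, mul_one, add_comm]
  rw [Unitary.mem_iff]
  have hs : star (ζ⁻¹ • (1 - A)) = (starRingEnd ℂ) ζ⁻¹ • (1 - star A) := by
    rw [star_smul, star_sub, star_one]; rfl
  rw [hs, smul_mul_smul_comm, smul_mul_smul_comm, hconj, hconj', one_smul, one_smul,
    sub_mul, sub_mul, mul_sub, mul_sub, mul_sub, mul_sub, e1, e2]
  constructor <;> simp

end Operators

/-! ### Generalized resolvents and the parameter C. -/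

namespace ClosedIsometry

section Resolvent

open Filter Topology

variable {H : Type*} [NormedAddCommGroup H] [InnerProductSpace ℂ H] [CompleteSpace H]
variable {V : ClosedIsometry H}

theorem toContinuousLinearEquiv_mem_unitary {K : Type*} [NormedAddCommGroup K]
    [InnerProductSpace ℂ K] [CompleteSpace K] (U : K ≃ₗᵢ[ℂ] K) :
    ((U : K ≃L[ℂ] K) : K →L[ℂ] K) ∈ unitary (K →L[ℂ] K) :=
  (Unitary.linearIsometryEquiv.symm U).2

theorem IsGeneralizedResolvent.star_eq {R : ℂ → H →L[ℂ] H}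
    (hR : V.IsGeneralizedResolvent R) {z : ℂ} (h0 : z ≠ 0) (hz : ‖z‖ ≠ 1) :
    star (R z) = 1 - R ((starRingEnd ℂ) z)⁻¹ := by
  obtain ⟨K, _, _, _, J, U, -, h⟩ := hR
  have hw : ‖((starRingEnd ℂ) z)⁻¹‖ ≠ 1 := by
    rw [norm_inv, RCLike.norm_conj]
    simpa using hz
  have hU := star_ringInverse_one_sub_smul (toContinuousLinearEquiv_mem_unitary U) h0 hz
  rw [h z hz, h _ hw, ContinuousLinearMap.star_eq_adjoint, ContinuousLinearMap.adjoint_comp,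
    ContinuousLinearMap.adjoint_comp, ContinuousLinearMap.adjoint_adjoint,
    ← ContinuousLinearMap.star_eq_adjoint (Ring.inverse _), hU]
  have hJ : J.toContinuousLinearMap.adjoint ∘L J.toContinuousLinearMap = 1 :=
    (ContinuousLinearMap.norm_map_iff_adjoint_comp_self _).1 J.norm_map
  ext x
  have hJx : J.toContinuousLinearMap.adjoint (J x) = x :=
    congrArg (fun T : H →L[ℂ] H => T x) hJ
  simp [hJx]

theorem IsGeneralizedResolvent.differentiableAt {R : ℂ → H →L[ℂ] H}
    (hR : V.IsGeneralizedResolvent R) {z : ℂ} (hz : ‖z‖ ≠ 1) : DifferentiableAt ℂ R z := by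
  obtain ⟨K, _, _, _, J, U, -, h⟩ := hR
  set u := ((U : K ≃L[ℂ] K) : K →L[ℂ] K)
  have h1 : DifferentiableAt ℂ (fun z : ℂ => Ring.inverse (1 - z • u)) z := by
    have := differentiableAt_inverse (𝕜 := ℂ)
      (isUnit_one_sub_smul_of_mem_unitary (toContinuousLinearEquiv_mem_unitary U) hz)
    exact DifferentiableAt.comp (f := fun z : ℂ => 1 - z • u) z this (by fun_prop)
  have h2 : DifferentiableAt ℂ (fun z : ℂ => J.toContinuousLinearMap.adjoint ∘L
      Ring.inverse (1 - z • u) ∘L J.toContinuousLinearMap) z :=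
    (differentiableAt_const _).clm_comp (h1.clm_comp (differentiableAt_const _))
  refine h2.congr_of_eventuallyEq ?_
  filter_upwards [(isOpen_ne_fun continuous_norm continuous_const).mem_nhds hz] with w hw
  exact h w hw

theorem continuous_oplus (V : ClosedIsometry H) : Continuous V.oplus :=
  continuous_const.add
    (continuous_const.clm_comp (continuous_id.clm_comp continuous_const))

/-- The compression of an operator in `H` to an operator from `N_0` into `N_∞`. -/
noncomputable def compress (V : ClosedIsometry H) (T : H →L[ℂ] H) : V.N 0 →L[ℂ] V.Ninf :=
  V.Ninf.orthogonalProjectionOnto ∘L T ∘L (V.N 0).subtypeL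

theorem compress_oplus (C : V.N 0 →L[ℂ] V.Ninf) : V.compress (V.oplus C) = C := by
  ext n
  simp [compress, oplus_apply_N_zero]

theorem continuous_compress (V : ClosedIsometry H) : Continuous V.compress :=
  continuous_const.clm_comp (continuous_id.clm_comp continuous_const)

theorem star_oplus_mul_oplus {C : V.N 0 →L[ℂ] V.Ninf} (hC : ∀ x, ‖C x‖ = ‖x‖) :
    star (V.oplus C) * V.oplus C = 1 := by
  refine (ContinuousLinearMap.norm_map_iff_adjoint_comp_self _).1 fun h => ?_
  set d := V.domain.orthogonalProjectionOnto h
  set n := (V.N 0).orthogonalProjectionOnto h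
  have h1 : inner ℂ (V.toFun d) (C n : H) = 0 := (C n).2 _ ⟨d, rfl⟩
  have h2 : inner ℂ (d : H) (n : H) = 0 := (V.N_zero.le n.2) _ d.2
  have h3 := norm_add_sq_eq_norm_sq_add_norm_sq_of_inner_eq_zero _ _ h1
  have h4 := norm_add_sq_eq_norm_sq_add_norm_sq_of_inner_eq_zero _ _ h2
  have h5 : ‖V.toFun d‖ = ‖(d : H)‖ := V.isometric d
  have h6 : ‖(C n : H)‖ = ‖(n : H)‖ := hC n
  rw [h5, h6, ← h4, V.domain_add_N_zero h] at h3
  rw [oplus_apply]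
  exact (mul_self_inj (norm_nonneg _) (norm_nonneg _)).1 h3

theorem norm_apply_of_oplus_mem_unitary {C : V.N 0 →L[ℂ] V.Ninf}
    (hC : V.oplus C ∈ unitary (H →L[ℂ] H)) (x : V.N 0) : ‖C x‖ = ‖x‖ := by
  have h := ContinuousLinearMap.norm_map_of_mem_unitary hC (x : H)
  rw [oplus_apply_N_zero] at h
  exact h

theorem surjective_of_oplus_mem_unitary {C : V.N 0 →L[ℂ] V.Ninf}
    (hC : V.oplus C ∈ unitary (H →L[ℂ] H)) : Function.Surjective C := by
  intro y
  -- The preimage of y under a unitary is its adjoint image; it is orthogonal to D(V) because y is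
  -- orthogonal to R(V).
  have hmem : star (V.oplus C) (y : H) ∈ V.N 0 := by
    rw [N_zero]
    intro x hx
    rw [ContinuousLinearMap.star_eq_adjoint, ContinuousLinearMap.adjoint_inner_right,
      V.oplus_apply_domain C ⟨x, hx⟩]
    exact y.2 _ ⟨⟨x, hx⟩, rfl⟩
  refine ⟨⟨_, hmem⟩, Subtype.ext ?_⟩
  rw [← oplus_apply_N_zero]
  exact congrArg (fun T : H →L[ℂ] H => T y) (Unitary.mem_iff.1 hC).2

end Resolvent

end ClosedIsometry

/-! ### The two implications. -/

namespace ClosedIsometry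

section Extension

open Filter Topology Metric Set

variable {H : Type*} [NormedAddCommGroup H] [InnerProductSpace ℂ H] [CompleteSpace H]
variable {V : ClosedIsometry H}

theorem norm_eq_one_of_isOpenArc {Δ : Set ℂ} (hΔ : IsOpenArc Δ) {ζ : ℂ} (hζ : ζ ∈ Δ) :
    ‖ζ‖ = 1 := by
  obtain ⟨a, b, -, rfl⟩ := hΔ
  obtain ⟨θ, -, rfl⟩ := hζ
  exact Complex.norm_exp_ofReal_mul_I θ

theorem conj_inv_eq_self {ζ : ℂ} (hζ : ‖ζ‖ = 1) : ((starRingEnd ℂ) ζ)⁻¹ = ζ := by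
  rw [← Complex.inv_eq_conj hζ, inv_inv]

/-- If the parameter has unitary boundary values on the arc for which `C - W` is bijective, then the
generalized resolvent is analytic across the arc. -/
theorem exists_analytic_continuation {Δ : Set ℂ} (hΔ : IsOpenArc Δ)
    (hreg : ∀ ζ ∈ Δ, V.IsRegularTypePoint ζ⁻¹)
    (hproj : ∀ ζ ∈ Δ, (V.M ζ).map (V.Minf.starProjection : H →ₗ[ℂ] H) = V.Minf)
    {R : ℂ → H →L[ℂ] H} (hR : V.IsGeneralizedResolvent R)
    {C : ℂ → V.N 0 →L[ℂ] V.Ninf} (hRC : V.Corresponds R C)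
    (hcont : ContinuousOn C (ball 0 1 ∪ Δ)) (hiso : ∀ l ∈ Δ, ∀ x, ‖C l x‖ = ‖x‖)
    (hW : ∀ l ∈ Δ, Function.Injective ((C l : V.N 0 →ₗ[ℂ] V.Ninf).toPMap ⊤ - V.W l) ∧
      range ((C l : V.N 0 →ₗ[ℂ] V.Ninf).toPMap ⊤ - V.W l) = univ) :
    ∃ R' : ℂ → H →L[ℂ] H, EqOn R' R {z | ‖z‖ < 1 ∨ 1 < ‖z‖} ∧
      AnalyticOnNhd ℂ R' ({z | ‖z‖ < 1 ∨ 1 < ‖z‖} ∪ Δ) := by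
  classical
  have hn : ∀ ζ ∈ Δ, ‖ζ‖ = 1 := fun ζ => norm_eq_one_of_isOpenArc hΔ
  have hunit : ∀ ζ ∈ Δ, IsUnit (1 - ζ • V.oplus (C ζ)) := fun ζ hζ =>
    ContinuousLinearMap.isUnit_iff_bijective.2
      ((bijective_one_sub_smul_oplus_iff (hn ζ hζ) (hreg ζ hζ) (hproj ζ hζ) (C ζ)).2 (hW ζ hζ))
  -- Values on the circle outside the arc are irrelevant.
  set R' : ℂ → H →L[ℂ] H := fun z =>
    if ‖z‖ = 1 then Ring.inverse (1 - z • V.oplus (C z)) else R z with hR'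
  have hoff : ∀ z, ‖z‖ ≠ 1 → R' z = R z := fun z hz => if_neg hz
  have hon : ∀ z ∈ ball (0 : ℂ) 1 ∪ Δ, R' z = Ring.inverse (1 - z • V.oplus (C z)) := by
    rintro z (hz | hz)
    · rw [hoff z (mem_ball_zero_iff.1 hz).ne]
      exact hRC z hz
    · exact if_pos (hn z hz)
  have hd : ∀ z, ‖z‖ ≠ 1 → DifferentiableAt ℂ R' z := by
    intro z hz
    refine (hR.differentiableAt hz).congr_of_eventuallyEq ?_
    filter_upwards [(isOpen_ne_fun continuous_norm continuous_const).mem_nhds hz] with w hw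
    exact hoff w hw
  have hin : ContinuousOn R' (ball 0 1 ∪ Δ) := by
    rintro z (hz | hz)
    · exact (hd z (mem_ball_zero_iff.1 hz).ne).continuousAt.continuousWithinAt
    · have h1 : ContinuousWithinAt (fun z => 1 - z • V.oplus (C z)) (ball 0 1 ∪ Δ) z :=
        continuousWithinAt_const.sub (continuousWithinAt_id.smul
          (V.continuous_oplus.continuousAt.comp_continuousWithinAt (hcont z (Or.inr hz))))
      have h2 : ContinuousAt Ring.inverse (1 - z • V.oplus (C z)) :=
        NormedRing.inverse_continuousAt (hunit z hz).unit
      exact (ContinuousAt.comp_continuousWithinAt (f := fun z => 1 - z • V.oplus (C z)) h2 h1).congr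
        hon (hon z (Or.inr hz))
  -- The reflection fixes each point of the arc, where the identity is X + X* = 1. It thus transfers
  -- continuity up to the arc from the inside to the outside.
  have hsymm : ∀ z ∈ {z : ℂ | 1 < ‖z‖} ∪ Δ, R' z = 1 - star (R' ((starRingEnd ℂ) z)⁻¹) := by
    rintro z (hz | hz)
    · have hz1 : ‖z‖ ≠ 1 := ne_of_gt hz
      have hz0 : z ≠ 0 := by
        rintro rfl
        simp only [mem_ofPred_eq, norm_zero] at hz
        exact absurd hz (by norm_num)
      have hw0 : ((starRingEnd ℂ) z)⁻¹ ≠ 0 := by simpa using hz0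
      have hw1 : ‖((starRingEnd ℂ) z)⁻¹‖ ≠ 1 := by
        rw [norm_inv, RCLike.norm_conj]
        simpa using hz1
      rw [hoff z hz1, hoff _ hw1, hR.star_eq hw0 hw1]
      simp
    · rw [conj_inv_eq_self (hn z hz), hon z (Or.inr hz)]
      exact eq_sub_of_add_eq
        (ringInverse_add_star_eq_one (star_oplus_mul_oplus (hiso z hz)) (hn z hz) (hunit z hz))
  have hout : ContinuousOn R' ({z | 1 < ‖z‖} ∪ Δ) := by
    have hz0 : ∀ z ∈ {z : ℂ | 1 < ‖z‖} ∪ Δ, 1 ≤ ‖z‖ := by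
      rintro z (hz | hz)
      · exact le_of_lt hz
      · exact (hn z hz).ge
    have h1 : ContinuousOn (fun z : ℂ => ((starRingEnd ℂ) z)⁻¹) ({z | 1 < ‖z‖} ∪ Δ) := by
      refine ContinuousOn.inv₀ Complex.continuous_conj.continuousOn fun z hz h => ?_
      rw [map_eq_zero] at h
      have := hz0 z hz
      rw [h, norm_zero] at this
      exact absurd this (by norm_num)
    have h2 : MapsTo (fun z : ℂ => ((starRingEnd ℂ) z)⁻¹) ({z | 1 < ‖z‖} ∪ Δ) (ball 0 1 ∪ Δ) := by
      rintro z (hz | hz)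
      · left
        rw [mem_ball_zero_iff, norm_inv, RCLike.norm_conj]
        exact inv_lt_one_of_one_lt₀ hz
      · right
        simpa only [conj_inv_eq_self (hn z hz)] using hz
    exact (continuousOn_const.sub (continuous_star.comp_continuousOn (hin.comp h1 h2))).congr hsymm
  refine ⟨R', fun z hz => hoff z (hz.elim ne_of_lt ne_of_gt), ?_⟩
  exact analyticOnNhd_union_arc hΔ hd hin hout

/-- A generalized resolvent that is analytic at a point `ζ` of the unit circle satisfies
`R_ζ + R_ζ* = E`. -/
theorem IsGeneralizedResolvent.add_star_eq_one {R : ℂ → H →L[ℂ] H}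
    (hR : V.IsGeneralizedResolvent R) {R' : ℂ → H →L[ℂ] H}
    (hRR' : EqOn R' R {z | ‖z‖ < 1 ∨ 1 < ‖z‖}) {ζ : ℂ} (hζ : ‖ζ‖ = 1) (hc : ContinuousAt R' ζ) :
    R' ζ + star (R' ζ) = 1 := by
  have hζ0 : ζ ≠ 0 := by rintro rfl; simp at hζ
  have hne : (𝓝[ball (0 : ℂ) 1] ζ).NeBot := by
    rw [← mem_closure_iff_nhdsWithin_neBot, closure_ball _ one_ne_zero]
    simp [hζ]
  have h1 : Tendsto (fun z => star (R' z)) (𝓝[ball (0 : ℂ) 1] ζ) (𝓝 (star (R' ζ))) :=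
    (continuous_star.tendsto _).comp (hc.tendsto.mono_left nhdsWithin_le_nhds)
  have hinv : ContinuousAt (fun z : ℂ => ((starRingEnd ℂ) z)⁻¹) ζ :=
    Complex.continuous_conj.continuousAt.inv₀ (by simpa using hζ0)
  have h2 : Tendsto (fun z => 1 - R' ((starRingEnd ℂ) z)⁻¹) (𝓝[ball (0 : ℂ) 1] ζ)
      (𝓝 (1 - R' ζ)) := by
    have hc' : ContinuousAt R' ((starRingEnd ℂ) ζ)⁻¹ := by rwa [conj_inv_eq_self hζ]
    have := (hc'.comp (f := fun z : ℂ => ((starRingEnd ℂ) z)⁻¹) hinv).tendsto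
    simp only [Function.comp_def, conj_inv_eq_self hζ] at this
    exact tendsto_const_nhds.sub (this.mono_left nhdsWithin_le_nhds)
  have heq : star (R' ζ) = 1 - R' ζ := by
    refine tendsto_nhds_unique_of_eventuallyEq h1 h2 ?_
    filter_upwards [self_mem_nhdsWithin, mem_nhdsWithin_of_mem_nhds (isOpen_ne.mem_nhds hζ0)]
      with z hz hz0
    have hz1 : ‖z‖ < 1 := mem_ball_zero_iff.1 hz
    have hw : 1 < ‖((starRingEnd ℂ) z)⁻¹‖ := by
      rw [norm_inv, RCLike.norm_conj]
      exact (one_lt_inv₀ (norm_pos_iff.2 hz0)).2 hz1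
    rw [hRR' (Or.inl hz1), hRR' (Or.inr hw), hR.star_eq hz0 hz1.ne]
  rw [heq]
  abel

/-- If the generalized resolvent is analytic across the arc, then the parameter has unitary
boundary values there, and `C - W` is bijective. -/
theorem exists_continuous_extension {Δ : Set ℂ} (hΔ : IsOpenArc Δ)
    (hreg : ∀ ζ ∈ Δ, V.IsRegularTypePoint ζ⁻¹)
    (hproj : ∀ ζ ∈ Δ, (V.M ζ).map (V.Minf.starProjection : H →ₗ[ℂ] H) = V.Minf)
    {R : ℂ → H →L[ℂ] H} (hR : V.IsGeneralizedResolvent R)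
    {C : ℂ → V.N 0 →L[ℂ] V.Ninf} (hC : ContinuousOn C (ball 0 1)) (hRC : V.Corresponds R C)
    {R' : ℂ → H →L[ℂ] H} (hRR' : EqOn R' R {z | ‖z‖ < 1 ∨ 1 < ‖z‖})
    (hc : ∀ ζ ∈ Δ, ContinuousAt R' ζ) :
    ∃ C' : ℂ → V.N 0 →L[ℂ] V.Ninf,
      EqOn C' C (ball 0 1) ∧ ContinuousOn C' (ball 0 1 ∪ Δ) ∧
      (∀ l ∈ Δ, (∀ x, ‖C' l x‖ = ‖x‖) ∧ Function.Surjective (C' l)) ∧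
      ∀ l ∈ Δ, Function.Injective ((C' l : V.N 0 →ₗ[ℂ] V.Ninf).toPMap ⊤ - V.W l) ∧
        range ((C' l : V.N 0 →ₗ[ℂ] V.Ninf).toPMap ⊤ - V.W l) = univ := by
  classical
  have hn : ∀ ζ ∈ Δ, ‖ζ‖ = 1 := fun ζ => norm_eq_one_of_isOpenArc hΔ
  have h0 : ∀ ζ ∈ Δ, ζ ≠ 0 := by
    rintro ζ hζ rfl
    simpa using hn 0 hζ
  have hadd : ∀ ζ ∈ Δ, R' ζ + star (R' ζ) = 1 := fun ζ hζ =>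
    hR.add_star_eq_one hRR' (hn ζ hζ) (hc ζ hζ)
  have hunit : ∀ ζ ∈ Δ, IsUnit (R' ζ) := fun ζ hζ => isUnit_of_add_star_eq_one (hadd ζ hζ)
  -- This solves R' = (1 - zT)⁻¹ for T, so it recovers V ⊕ C(z) at points of the disc near the arc.
  set Φ : ℂ → H →L[ℂ] H := fun z => z⁻¹ • (1 - Ring.inverse (R' z)) with hΦ
  have hΦc : ∀ ζ ∈ Δ, ContinuousAt Φ ζ := fun ζ hζ => by
    have h2 : ContinuousAt Ring.inverse (R' ζ) :=
      NormedRing.inverse_continuousAt (hunit ζ hζ).unit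
    exact (continuousAt_inv₀ (h0 ζ hζ)).smul (continuousAt_const.sub (h2.comp (hc ζ hζ)))
  have hΦC : ∀ ζ ∈ Δ, ∀ᶠ z in 𝓝 ζ, z ∈ ball (0 : ℂ) 1 → Φ z = V.oplus (C z) := by
    intro ζ hζ
    filter_upwards [(hc ζ hζ).eventually_mem (Units.isOpen.mem_nhds (hunit ζ hζ)),
      isOpen_ne.mem_nhds (h0 ζ hζ)] with z hz hz0 hzb
    have hz' : IsUnit (R' z) := hz
    rw [hRR' (Or.inl (mem_ball_zero_iff.1 hzb)), hRC z hzb, isUnit_ringInverse] at hz'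
    simp only [hΦ]
    rw [hRR' (Or.inl (mem_ball_zero_iff.1 hzb)), hRC z hzb, Ring.inverse_inverse hz',
      sub_sub_cancel, inv_smul_smul₀ hz0]
  -- Being of the form V ⊕ C is a closed condition, so it passes to the boundary limit.
  have hoplus : ∀ ζ ∈ Δ, V.oplus (V.compress (Φ ζ)) = Φ ζ := by
    intro ζ hζ
    have hne : (𝓝[ball (0 : ℂ) 1] ζ).NeBot := by
      rw [← mem_closure_iff_nhdsWithin_neBot, closure_ball _ one_ne_zero]
      simp [hn ζ hζ]
    have h1 : Tendsto Φ (𝓝[ball (0 : ℂ) 1] ζ) (𝓝 (Φ ζ)) :=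
      (hΦc ζ hζ).tendsto.mono_left nhdsWithin_le_nhds
    have h2 : Tendsto (fun z => V.oplus (V.compress (Φ z))) (𝓝[ball (0 : ℂ) 1] ζ)
        (𝓝 (V.oplus (V.compress (Φ ζ)))) :=
      ((V.continuous_oplus.comp V.continuous_compress).tendsto _).comp h1
    refine tendsto_nhds_unique_of_eventuallyEq h2 h1 ?_
    filter_upwards [self_mem_nhdsWithin, mem_nhdsWithin_of_mem_nhds (hΦC ζ hζ)] with z hz hz'
    rw [hz' hz, compress_oplus]
  have hU : ∀ ζ ∈ Δ, V.oplus (V.compress (Φ ζ)) ∈ unitary (H →L[ℂ] H) := fun ζ hζ => by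
    rw [hoplus ζ hζ]
    exact smul_one_sub_ringInverse_mem_unitary (hadd ζ hζ) (hn ζ hζ)
  set C' : ℂ → V.N 0 →L[ℂ] V.Ninf := fun z =>
    if z ∈ ball (0 : ℂ) 1 then C z else V.compress (Φ z) with hC'
  have hball : EqOn C' C (ball 0 1) := fun z hz => if_pos hz
  have harc : ∀ ζ ∈ Δ, C' ζ = V.compress (Φ ζ) := fun ζ hζ => if_neg (by simp [hn ζ hζ])
  refine ⟨C', hball, ?_, ?_, ?_⟩
  · rintro z (hz | hz)
    · have h1 : ContinuousAt C z := (hC z hz).continuousAt (isOpen_ball.mem_nhds hz)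
      refine (h1.congr ?_).continuousWithinAt
      filter_upwards [isOpen_ball.mem_nhds hz] with w hw
      exact (hball hw).symm
    · have h1 : ContinuousAt (fun w => V.compress (Φ w)) z :=
        V.continuous_compress.continuousAt.comp (hΦc z hz)
      refine h1.continuousWithinAt.congr_of_eventuallyEq ?_ (harc z hz)
      filter_upwards [self_mem_nhdsWithin, mem_nhdsWithin_of_mem_nhds (hΦC z hz)] with w hw hw'
      rcases hw with hw | hw
      · rw [hball hw, hw' hw, compress_oplus]
      · exact harc w hw
  · intro ζ hζ
    rw [harc ζ hζ]
    exact ⟨norm_apply_of_oplus_mem_unitary (hU ζ hζ), surjective_of_oplus_mem_unitary (hU ζ hζ)⟩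
  · intro ζ hζ
    rw [harc ζ hζ]
    refine (bijective_one_sub_smul_oplus_iff (hn ζ hζ) (hreg ζ hζ) (hproj ζ hζ) _).1 ?_
    rw [hoplus ζ hζ]
    simp only [hΦ]
    rw [smul_inv_smul₀ (h0 ζ hζ), sub_sub_cancel]
    exact ContinuousLinearMap.isUnit_iff_bijective.1 (isUnit_ringInverse.2 (hunit ζ hζ))

end Extension

end ClosedIsometry

theorem theorem5p3 {H : Type*} [NormedAddCommGroup H] [InnerProductSpace ℂ H] [CompleteSpace H]
    (V : ClosedIsometry H) (Δ : Set ℂ) (hΔ : IsOpenArc Δ)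
    (hreg : ∀ ζ ∈ Δ, V.IsRegularTypePoint ζ⁻¹)
    (hproj : ∀ ζ ∈ Δ, (V.M ζ).map (V.Minf.starProjection : H →ₗ[ℂ] H) = V.Minf)
    (R : ℂ → H →L[ℂ] H) (hR : V.IsGeneralizedResolvent R)
    (C : ℂ → V.N 0 →L[ℂ] V.Ninf) (hC : C ∈ schurClass (V.N 0) V.Ninf)
    (hRC : V.Corresponds R C) :
    (∃ R' : ℂ → H →L[ℂ] H,
        Set.EqOn R' R {z | ‖z‖ < 1 ∨ 1 < ‖z‖} ∧
        AnalyticOnNhd ℂ R' ({z | ‖z‖ < 1 ∨ 1 < ‖z‖} ∪ Δ)) ↔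
      ∃ C' : ℂ → V.N 0 →L[ℂ] V.Ninf,
        Set.EqOn C' C (Metric.ball 0 1) ∧
        ContinuousOn C' (Metric.ball 0 1 ∪ Δ) ∧
        (∀ l ∈ Δ, (∀ x, ‖C' l x‖ = ‖x‖) ∧ Function.Surjective (C' l)) ∧
        ∀ l ∈ Δ,
          Function.Injective ((C' l : V.N 0 →ₗ[ℂ] V.Ninf).toPMap ⊤ - V.W l) ∧
          Set.range ((C' l : V.N 0 →ₗ[ℂ] V.Ninf).toPMap ⊤ - V.W l) = Set.univ := by
  constructor
  · rintro ⟨R', hRR', hA⟩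
    exact ClosedIsometry.exists_continuous_extension hΔ hreg hproj hR hC.1.continuousOn hRC hRR'
      fun ζ hζ => (hA ζ (Or.inr hζ)).continuousAt
  · rintro ⟨C', hCC', hcont, hiso, hW⟩
    refine ClosedIsometry.exists_analytic_continuation hΔ hreg hproj hR (C := C') ?_ hcont
      (fun l hl => (hiso l hl).1) hW
    intro z hz
    rw [hCC' hz]
    exact hRC z hz
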